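/- For a partition $\lambda$, let $|\lambda|$ be its size. For $t\ge 2$, the hook length of a cell of the Young diagram of $\lambda$ is the number of cells to its right plus the number of cells below it plus one. The $t$-core $\lambda_{(t)}$ is the partition obtained from $\lambda$ by successively deleting (rim) hooks of length divisible by $t$ until none is left. The $t$-quotient $\lambda^{(t)}$ is the $t$-tuple of partitions read off the runners of the $t$-abacus of $\lambda$: take $N$ a multiple of $t$ that is at least the number of parts of $\lambda=(\lambda_1\ge\dots\ge\lambda_N\ge 0)$ and $X=\{\lambda_i+N-i : 1\le i\le N\}$; for $0\le r<t$, the partition indexed by $r$ is the one whose set of beta-numbers is $\{x : tx+r\in X\}$. Put $\alpha_0(t;\lambda)=(\lambda)$, let $\alpha_{j+1}(t;\lambda)$ be the sequence of $t^{j+1}$ partitions formed by taking in order the $t$-quotients of all partitions in $\alpha_j(t;\lambda)$, and let $\beta_j(t;\lambda)$, the $j$-th row of the $t$-core tower of $\lambda$, be the sequence of the $t$-cores of the partitions in $\alpha_j(t;\lambda)$. Let $|\beta_j(t;\lambda)|$ be the sum of the sizes of the partitions in $\beta_j(t;\lambda)$, and define the formal power series $$T_{j,t}(q)=\sum_{\lambda}|\beta_j(t;\lambda)|\,q^{|\lambda|},\qquad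 G_2^0(q)=\sum_{n\ge1}\sigma_1(n)q^n,\qquad (q)_\infty=\prod_{n\ge1}(1-q^n),$$ where $\lambda$ runs over all integer partitions (including the empty one) and $\sigma_1(n)=\sum_{d\mid n}d$. **Theorem.** For all $t\ge2$ and $j\ge0$, $$T_{j,t}(q)=\frac{t^{j}\,G_2^0\!\left(q^{t^{j}}\right)-t^{j+2}\,G_2^0\!\left(q^{t^{j+1}}\right)}{(q)_\infty}.$$ Moreover $T_{0,t}(q)=\sum_\lambda|\lambda_{(t)}|\,q^{|\lambda|}$, so the case $j=0$ gives the generating function that weights partitions by the size of their $t$-core. -/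

import Mathlib

namespace CoreTower

/-! ### Partitions and their Young diagrams -/

/-- The Young diagram of an integer partition: the parts, in weakly decreasing order, are the
row lengths. -/
def diagram {n : ℕ} (p : n.Partition) : YoungDiagram :=
  YoungDiagram.ofRowLens (p.parts.sort (· ≥ ·))
    (List.sortedGE_iff_pairwise.2 (Multiset.pairwise_sort p.parts (· ≥ ·)))

/-! ### Hooks and cores -/

/-- The hook length of the cell `(i, j)` of `μ`: the number of cells to its right, plus the number
of cells below it, plus one. -/
def hookLength (μ : YoungDiagram) (i j : ℕ) : ℕ :=
  (μ.rowLen i - (j + 1)) + (μ.colLen j - (i + 1)) + 1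

/-- Deleting from `μ` the hook of the cell `(i, j)`. As usual this means deleting the corresponding
rim hook: the cells weakly below and weakly right of `(i, j)` whose lower right diagonal
neighbour is not in `μ`. -/
def deleteHook (μ : YoungDiagram) (i j : ℕ) : YoungDiagram where
  cells := μ.cells.filter fun c => ¬ (i ≤ c.1 ∧ j ≤ c.2 ∧ (c.1 + 1, c.2 + 1) ∉ μ)
  isLowerSet := by
    rintro ⟨a, b⟩ ⟨a', b'⟩ hle hab
    obtain ⟨h1, h2⟩ := Prod.mk_le_mk.1 hle
    simp only [Finset.coe_filter, Set.mem_ofPred_eq, YoungDiagram.mem_cells] at hab ⊢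
    refine ⟨μ.up_left_mem h1 h2 hab.1, ?_⟩
    rintro ⟨hi, hj, hn⟩
    exact hab.2 ⟨hi.trans h1, hj.trans h2, fun h => hn (μ.up_left_mem (by omega) (by omega) h)⟩

theorem card_deleteHook_lt {μ : YoungDiagram} {i j : ℕ} (h : (i, j) ∈ μ) :
    (deleteHook μ i j).card < μ.card := by
  have hj : j < μ.rowLen i := YoungDiagram.mem_iff_lt_rowLen.1 h
  refine Finset.card_lt_card (Finset.filter_ssubset.2 ⟨(i, μ.rowLen i - 1), ?_, ?_⟩)
  · rw [YoungDiagram.mem_cells, YoungDiagram.mem_iff_lt_rowLen]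
    omega
  · rw [not_not, YoungDiagram.mem_iff_lt_rowLen]
    have := μ.rowLen_anti i (i + 1) (by omega)
    dsimp only
    omega

/-- `ν` arises from `μ` by deleting one hook of length divisible by `t`. -/
def HookStep (t : ℕ) (μ ν : YoungDiagram) : Prop :=
  ∃ i j : ℕ, (i, j) ∈ μ ∧ t ∣ hookLength μ i j ∧ ν = deleteHook μ i j

/-- `μ` is a `t`-core: no hook length of `μ` is divisible by `t`. -/
def IsCore (t : ℕ) (μ : YoungDiagram) : Prop :=
  ∀ i j : ℕ, (i, j) ∈ μ → ¬ t ∣ hookLength μ i j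

/-- `κ` is a `t`-core obtained from `μ` by successively deleting hooks of length divisible
by `t`. -/
def IsCoreOf (t : ℕ) (μ κ : YoungDiagram) : Prop :=
  Relation.ReflTransGen (HookStep t) μ κ ∧ IsCore t κ

theorem exists_isCoreOf (t : ℕ) (μ : YoungDiagram) : ∃ κ, IsCoreOf t μ κ := by
  induction hn : μ.card using Nat.strong_induction_on generalizing μ with
  | _ n ih =>
    by_cases hc : IsCore t μ
    · exact ⟨μ, Relation.ReflTransGen.refl, hc⟩
    · simp only [IsCore, not_forall, not_not] at hc
      obtain ⟨i, j, hij, hd⟩ := hc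
      obtain ⟨κ, hκ⟩ := ih _ (hn ▸ card_deleteHook_lt hij) (deleteHook μ i j) rfl
      exact ⟨κ, Relation.ReflTransGen.head ⟨i, j, hij, hd, rfl⟩ hκ.1, hκ.2⟩

/-- The `t`-core of `μ`: what remains after successively deleting hooks of length divisible by `t`
until no such hook is left. (Classically, the outcome does not depend on the deletions made.) -/
noncomputable def core (t : ℕ) (μ : YoungDiagram) : YoungDiagram :=
  Classical.choose (exists_isCoreOf t μ)

/-! ### Quotients, through beta-numbers and the `t`-abacus -/

/-- The set of `N` beta-numbers (first column hook lengths) of `μ`, where `N` is at least the number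
of parts of `μ` and `μ` is padded by parts equal to `0`: the `i`-th part, `0 ≤ i < N`, contributes
`μ_i + (N - 1 - i)`. -/
def betaSet (N : ℕ) (μ : YoungDiagram) : Finset ℕ :=
  (Finset.range N).image fun i => μ.rowLen i + (N - 1 - i)

/-- The number of natural numbers below `y` that do not belong to `Y`. -/
def gaps (Y : Finset ℕ) (y : ℕ) : ℕ := (Finset.range y \ Y).card

theorem gaps_mono (Y : Finset ℕ) : Monotone (gaps Y) := fun _ _ h =>
  Finset.card_le_card (Finset.sdiff_subset_sdiff (Finset.range_mono h) subset_rfl)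

/-- The partition with the beta-numbers `Y`: each `y ∈ Y` gives a part (possibly `0`), equal to
the number of gaps of `Y` below `y`. -/
def ofBetaSet (Y : Finset ℕ) : YoungDiagram :=
  YoungDiagram.ofRowLens ((Y.sort (· ≥ ·)).map (gaps Y))
    (List.sortedGE_iff_pairwise.2
      (List.Pairwise.map (gaps Y) (fun _ _ h => gaps_mono Y h) (Finset.pairwise_sort Y (· ≥ ·))))

/-- The positions of the beads of `X` on runner `r` of the `t`-abacus: all `x` with
`t * x + r ∈ X`, for `r < t`. -/
def runner (t r : ℕ) (X : Finset ℕ) : Finset ℕ :=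
  (X.filter fun x => x % t = r).image fun x => x / t

/-- The `t`-quotient of `μ`, a `t`-tuple of partitions: the `r`-th one is read off runner `r`
of the `t`-abacus of `μ`, with the usual normalization that the number of beads is
a multiple of `t` (and at least the number of parts). -/
def quotient (t : ℕ) (μ : YoungDiagram) : List YoungDiagram :=
  (List.range t).map fun r => ofBetaSet (runner t r (betaSet (t * μ.colLen 0) μ))

/-! ### The core tower -/

/-- The `j`-th row `α_j(t; μ)` of the `t`-core pre-tower: row `0` is `μ`, and each next
row lists, in order, the `t`-quotients of the partitions of the row before. -/
def preTowerRow (t : ℕ) (μ : YoungDiagram) : ℕ → List YoungDiagram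
  | 0 => [μ]
  | j + 1 => (preTowerRow t μ j).flatMap (quotient t)

/-- The `j`-th row `β_j(t; μ)` of the `t`-core tower: the `t`-cores of the partitions in
`α_j(t; μ)`. -/
noncomputable def towerRow (t : ℕ) (μ : YoungDiagram) (j : ℕ) : List YoungDiagram :=
  (preTowerRow t μ j).map (core t)

/-- The total size of a family of partitions. -/
def totalSize (L : List YoungDiagram) : ℕ := (L.map YoungDiagram.card).sum

/-! ### The `q`-series -/

/-- The formal power series `∑_λ w(λ) q^{|λ|}` over all integer partitions `λ`. -/
noncomputable def partitionSeries (w : YoungDiagram → ℕ) : PowerSeries ℚ :=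
  PowerSeries.mk fun n => ∑ p : n.Partition, (w (diagram p) : ℚ)

/-- `T_{j,t}(q) = ∑_λ |β_j(t; λ)| q^{|λ|}`. -/
noncomputable def T (j t : ℕ) : PowerSeries ℚ :=
  partitionSeries fun μ => totalSize (towerRow t μ j)

/-- `G_2^0(q) = ∑_{n ≥ 1} σ_1(n) q^n` (note `sigma 1 0 = 0`). -/
noncomputable def G20 : PowerSeries ℚ :=
  PowerSeries.mk fun n => (ArithmeticFunction.sigma 1 n : ℚ)

open scoped PowerSeries.WithPiTopology in
/-- `(q)_∞ = ∏_{n ≥ 0} (1 - q^{n + 1})`, a convergent infinite product of formal power series. -/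
noncomputable def qInf : PowerSeries ℚ :=
  ∏' n : ℕ, (1 - PowerSeries.X ^ (n + 1))

open scoped PowerSeries.WithPiTopology in
theorem hasProd_qInf :
    HasProd (fun n : ℕ => (1 - PowerSeries.X ^ (n + 1) : PowerSeries ℚ)) qInf :=
  (PowerSeries.WithPiTopology.multipliable_one_sub_X_pow ℚ).hasProd

open scoped PowerSeries.WithPiTopology in
/-- The constant term of `(q)_∞` is `1`, so `qInf⁻¹` is a genuine inverse. -/
theorem constantCoeff_qInf : PowerSeries.constantCoeff qInf = (1 : ℚ) := by
  simp [qInf, (PowerSeries.WithPiTopology.multipliable_one_sub_X_pow ℚ).map_tprod _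
    (PowerSeries.WithPiTopology.continuous_constantCoeff ℚ)]

end CoreTower

/-!
Everything is read off the beta-sets. A hook of length `h` of a partition is a bead `x` of its
beta-set together with a free place `x - h`, and deleting the hook moves the bead to that place
(`betaSet_deleteHook`, `exists_hookLength_eq`). Write `D_m(λ)` for the number of hooks of `λ` of
length divisible by `m` (`divHooks`). The proof combines three facts.

* Two places on the same runner of the `t`-abacus at distance `h` are at distance `t h` in the
  beta-set, so the `D_m` of the members of the `t`-quotient add up to `D_{tm}(λ)`
  (`sum_divHooks_quotient`). Since `D_1(λ) = |λ|`, the `j`-th row of the pre-tower has total size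
  `D_{t^j}(λ)`.
* Deleting a hook of length `t h` lowers `|λ|` by `t h` and `D_t(λ)` by `h`, and a `t`-core has
  `D_t = 0`. Hence `|λ| = |λ_(t)| + t D_t(λ)` for whatever core the deletions lead to
  (`card_core_add`), and summing over row `j` of the pre-tower gives
  `|β_j(t; λ)| = D_{t^j}(λ) - t D_{t^{j+1}}(λ)` (`totalSize_towerRow`).
* Moving a bead down by `k` is a bijection from partitions with a marked `k`-hook to partitions of
  size smaller by `k` with a marked bead that can move up by `k`, and of the latter there are
  exactly `k` more than there are `k`-hooks (`card_filter_add_notMem`). So the series `H_k` counting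
  the `k`-hooks of all partitions satisfies `H_k = q^k (H_k + k P)` with `P = 1 / (q)_∞`
  (`sum_hookCount_add`); summing `H_k = k q^k / (1 - q^k) P` over the multiples `k` of `m` gives
  `∑_λ D_m(λ) q^|λ| = m G(q^m) / (q)_∞` (`partitionSeries_divHooks`).
-/

namespace CoreTower

open Finset

/-! ### Hooks as pairs of a bead and a free place below it -/

/-- The number of pairs `z < x` with a bead of `X` at `x`, no bead at `z`, and `m ∣ x - z`. For the
beta-set `X` of a partition these pairs are the hooks of length divisible by `m`. -/
def divHookCount (m : ℕ) (X : Finset ℕ) : ℕ :=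
  ∑ x ∈ X, #{z ∈ range x | z ∉ X ∧ m ∣ x - z}

/-- The number of beads of `X` that can be moved down by `k` places to a free place. For the
beta-set `X` of a partition and `k ≥ 1` this is the number of hooks of length `k`. -/
def hookCount (k : ℕ) (X : Finset ℕ) : ℕ :=
  #{x ∈ X | k ≤ x ∧ x - k ∉ X}

theorem divHookCount_one (X : Finset ℕ) : divHookCount 1 X = ∑ x ∈ X, gaps X x := by
  refine sum_congr rfl fun x _ => congrArg card ?_
  ext z
  simp

/-- The size of a partition, as the sum of its beta-numbers minus that of the empty partition. -/
theorem sum_gaps_add_choose (X : Finset ℕ) :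
    ∑ x ∈ X, gaps X x + (#X).choose 2 = ∑ x ∈ X, x := by
  induction X using Finset.induction_on_max with
  | empty => simp
  | insert a s hs ih =>
    have ha : a ∉ s := fun h => lt_irrefl a (hs a h)
    have hg : ∀ x ≤ a, gaps (insert a s) x = gaps s x := by
      intro x hx
      refine congrArg card ?_
      ext z
      simp only [mem_sdiff, mem_range, mem_insert, not_or]
      constructor
      · rintro ⟨h1, -, h2⟩
        exact ⟨h1, h2⟩
      · rintro ⟨h1, h2⟩
        exact ⟨h1, by omega, h2⟩
    have hsub : s ⊆ range a := fun x hx => mem_range.2 (hs x hx)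
    have hga : gaps s a + #s = a := by
      have := card_sdiff_add_card_eq_card hsub
      rwa [card_range] at this
    have hsum : ∑ x ∈ s, gaps (insert a s) x = ∑ x ∈ s, gaps s x :=
      sum_congr rfl fun x hx => hg x (hs x hx).le
    rw [sum_insert ha, sum_insert ha, card_insert_of_notMem ha, hg a le_rfl, hsum,
      show (#s + 1).choose 2 = #s + (#s).choose 2 by simp [Nat.choose_succ_succ' (#s) 1]]
    omega

theorem divHookCount_one_add_choose (X : Finset ℕ) :
    divHookCount 1 X + (#X).choose 2 = ∑ x ∈ X, x := by
  rw [divHookCount_one, sum_gaps_add_choose]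

/-- Moving all beads up by one place and adding a bead at `0` does not change the hook counts. -/
theorem divHookCount_insert_zero_image_succ (m : ℕ) (X : Finset ℕ) :
    divHookCount m (insert 0 (X.image Nat.succ)) = divHookCount m X := by
  have h0 : 0 ∉ X.image Nat.succ := by simp
  unfold divHookCount
  rw [sum_insert h0, sum_image (fun a _ b _ h => Nat.succ_injective h)]
  simp only [range_zero, filter_empty, card_empty, zero_add]
  refine sum_congr rfl fun x _ => ?_
  symm
  refine card_bij (fun z _ => z + 1) ?_ ?_ ?_
  · intro z hz
    simp only [mem_filter, mem_range, mem_insert, mem_image, Nat.succ_eq_add_one] at hz ⊢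
    refine ⟨by omega, ?_, by simpa using hz.2.2⟩
    rintro (h | ⟨a, ha, hb⟩)
    · omega
    · exact hz.2.1 (by rwa [show z = a by omega])
  · intro a _ b _ h
    omega
  · intro z hz
    simp only [mem_filter, mem_range, mem_insert, mem_image, Nat.succ_eq_add_one, not_or] at hz
    obtain ⟨h1, ⟨h2, h3⟩, h4⟩ := hz
    obtain ⟨w, rfl⟩ := Nat.exists_eq_succ_of_ne_zero h2
    refine ⟨w, ?_, rfl⟩
    simp only [mem_filter, mem_range]
    refine ⟨by omega, fun hw => h3 ⟨w, hw, rfl⟩, by simpa using h4⟩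

theorem mem_runner {t r : ℕ} (hr : r < t) {X : Finset ℕ} {y : ℕ} :
    y ∈ runner t r X ↔ t * y + r ∈ X := by
  simp only [runner, mem_image, mem_filter]
  constructor
  · rintro ⟨x, ⟨hx, h⟩, rfl⟩
    rwa [← h, Nat.div_add_mod]
  · intro h
    exact ⟨_, ⟨h, by rw [Nat.mul_add_mod, Nat.mod_eq_of_lt hr]⟩, by
      rw [Nat.mul_add_div (by omega), Nat.div_eq_of_lt hr, add_zero]⟩

theorem injOn_div_filter_mod (t r : ℕ) (X : Finset ℕ) :
    Set.InjOn (fun x => x / t) (X.filter fun x => x % t = r : Finset ℕ) := by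
  intro a ha b hb h
  simp only [coe_filter, Set.mem_ofPred_eq] at ha hb h
  rw [← Nat.div_add_mod a t, ← Nat.div_add_mod b t, ha.2, hb.2, h]

theorem card_runner (t r : ℕ) (X : Finset ℕ) : #(runner t r X) = #{x ∈ X | x % t = r} :=
  card_image_of_injOn (injOn_div_filter_mod t r X)

theorem sum_runner (t : ℕ) (ht : 0 < t) (X : Finset ℕ) (f : ℕ → ℕ → ℕ) :
    ∑ r ∈ range t, ∑ y ∈ runner t r X, f r y = ∑ x ∈ X, f (x % t) (x / t) := by
  refine Eq.trans ?_ (sum_fiberwise_of_maps_to (g := fun x => x % t) (t := range t)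
    (fun x _ => mem_range.2 (Nat.mod_lt x ht)) _)
  refine sum_congr rfl fun r _ => ?_
  rw [runner, sum_image (injOn_div_filter_mod t r X)]
  refine sum_congr rfl fun x hx => ?_
  rw [(mem_filter.1 hx).2]

/-- The hooks of length divisible by `m` on the runners of the `t`-abacus are the hooks of
length divisible by `t * m`. -/
theorem sum_divHookCount_runner (t m : ℕ) (ht : 0 < t) (X : Finset ℕ) :
    ∑ r ∈ range t, divHookCount m (runner t r X) = divHookCount (t * m) X := by
  unfold divHookCount
  rw [sum_runner t ht X fun r y => #{z ∈ range y | z ∉ runner t r X ∧ m ∣ y - z}]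
  refine sum_congr rfl fun x _ => ?_
  have hr := Nat.mod_lt x ht
  have hx := Nat.div_add_mod x t
  refine card_bij (fun z _ => t * z + x % t) ?_ ?_ ?_
  · intro z hz
    simp only [mem_filter, mem_range, mem_runner hr] at hz ⊢
    obtain ⟨h1, h2, h3⟩ := hz
    have h4 : t * z < t * (x / t) := Nat.mul_lt_mul_of_pos_left h1 ht
    refine ⟨by omega, h2, ?_⟩
    rw [show x - (t * z + x % t) = t * (x / t - z) by rw [Nat.mul_sub]; omega]
    exact Nat.mul_dvd_mul_left t h3
  · intro a _ b _ h
    exact Nat.eq_of_mul_eq_mul_left ht (Nat.add_right_cancel h)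
  · intro z hz
    simp only [mem_filter, mem_range] at hz
    obtain ⟨h1, h2, h3⟩ := hz
    have hmod : z % t = x % t := (Nat.modEq_iff_dvd' h1.le).2 ((Dvd.intro m rfl).trans h3)
    have hz := Nat.div_add_mod z t
    rw [hmod] at hz
    refine ⟨z / t, ?_, hz⟩
    simp only [mem_filter, mem_range, mem_runner hr, hz]
    have h4 : z / t < x / t := by
      by_contra h
      have := Nat.mul_le_mul_left t (not_lt.1 h)
      omega
    refine ⟨h4, h2, ?_⟩
    rw [show x - z = t * (x / t - z / t) by rw [Nat.mul_sub]; omega] at h3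
    exact Nat.dvd_of_mul_dvd_mul_left ht h3

/-- `divHookCount_one_add_choose` summed over the runners of the `t`-abacus. -/
theorem divHookCount_add_sum_choose (t : ℕ) (ht : 0 < t) (X : Finset ℕ) :
    divHookCount t X + ∑ r ∈ range t, (#{x ∈ X | x % t = r}).choose 2 = ∑ x ∈ X, x / t := by
  rw [← sum_runner t ht X fun _ y => y, ← mul_one t, ← sum_divHookCount_runner t 1 ht, mul_one,
    ← sum_add_distrib]
  refine sum_congr rfl fun r _ => ?_
  rw [← card_runner, divHookCount_one_add_choose]

/-- Moving a bead down by `t * h` places lowers the number of hooks of length divisible by `t`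
by `h`. -/
theorem divHookCount_insert_erase {t h x : ℕ} (ht : 0 < t) {X : Finset ℕ} (hx : x ∈ X)
    (hle : t * h ≤ x) (hn : x - t * h ∉ X) :
    divHookCount t (insert (x - t * h) (X.erase x)) + h = divHookCount t X := by
  have hn' : x - t * h ∉ X.erase x := fun h => hn (mem_of_mem_erase h)
  have h1 := divHookCount_add_sum_choose t ht X
  have h2 := divHookCount_add_sum_choose t ht (insert (x - t * h) (X.erase x))
  have h3 : ∑ x ∈ insert (x - t * h) (X.erase x), x / t + h = ∑ x ∈ X, x / t := by
    rw [sum_insert hn', ← add_sum_erase X _ hx, Nat.sub_mul_div]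
    have : h ≤ x / t := (Nat.le_div_iff_mul_le ht).2 (by rwa [mul_comm])
    omega
  have h4 : ∀ r, #{y ∈ insert (x - t * h) (X.erase x) | y % t = r} = #{y ∈ X | y % t = r} := by
    intro r
    have hm : (x - t * h) % t = x % t := Nat.sub_mul_mod hle
    rw [card_filter, card_filter, sum_insert hn', ← add_sum_erase X _ hx, hm]
  simp only [h4] at h2
  omega

theorem divHookCount_eq_sum_hookCount {m : ℕ} (hm : 0 < m) {X : Finset ℕ} {K : ℕ}
    (hK : ∀ x ∈ X, x ≤ K) :
    divHookCount m X = ∑ l ∈ Icc 1 K, hookCount (m * l) X := by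
  simp only [hookCount, card_filter]
  rw [sum_comm]
  refine sum_congr rfl fun x hx => ?_
  rw [← card_filter]
  symm
  refine card_bij (fun l _ => x - m * l) ?_ ?_ ?_
  · intro l hl
    simp only [mem_filter, mem_Icc, mem_range] at hl ⊢
    obtain ⟨⟨h1, -⟩, h2, h3⟩ := hl
    have : 0 < m * l := Nat.mul_pos hm h1
    refine ⟨by omega, h3, ?_⟩
    rw [Nat.sub_sub_self h2]
    exact Nat.dvd_mul_right m l
  · intro a ha b hb h
    simp only [mem_filter, mem_Icc] at ha hb
    exact Nat.eq_of_mul_eq_mul_left hm (by omega)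
  · intro z hz
    simp only [mem_filter, mem_range] at hz
    obtain ⟨h1, h2, l, hl⟩ := hz
    refine ⟨l, ?_, by omega⟩
    have hl0 : l ≠ 0 := by
      rintro rfl
      omega
    have : l ≤ m * l := Nat.le_mul_of_pos_left l hm
    have := hK x hx
    simp only [mem_filter, mem_Icc]
    refine ⟨by omega, by omega, ?_⟩
    rwa [show x - m * l = z by omega]

/-- If the places below `k` are all occupied, then `k` more beads can be moved up by `k` than
can be moved down by `k`. -/
theorem card_filter_add_notMem {k : ℕ} {X : Finset ℕ} (hX : range k ⊆ X) :
    #{x ∈ X | x + k ∉ X} = hookCount k X + k := by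
  have h1 := card_filter_add_card_filter_not (s := X) fun x => x + k ∈ X
  have h2 := card_filter_add_card_filter_not (s := X) fun x => x < k
  have h3 : #{x ∈ X | x < k} = k := by
    rw [show X.filter (· < k) = range k by
      ext x
      simp only [mem_filter, mem_range]
      exact ⟨fun h => h.2, fun h => ⟨hX (mem_range.2 h), h⟩⟩, card_range]
  have h4 := card_filter_add_card_filter_not (s := X.filter fun x => ¬ x < k) fun x => x - k ∈ X
  have h5 : #{x ∈ X.filter (fun x => ¬ x < k) | x - k ∈ X} = #{x ∈ X | x + k ∈ X} := by
    refine card_nbij' (fun x => x - k) (fun x => x + k) ?_ ?_ ?_ ?_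
    · intro x hx
      simp only [coe_filter, mem_filter, Set.mem_ofPred_eq] at hx ⊢
      refine ⟨hx.2, ?_⟩
      rw [Nat.sub_add_cancel (not_lt.1 hx.1.2)]
      exact hx.1.1
    · intro x hx
      simp only [coe_filter, mem_filter, Set.mem_ofPred_eq] at hx ⊢
      refine ⟨⟨hx.2, by omega⟩, by simpa using hx.1⟩
    · intro x hx
      simp only [coe_filter, mem_filter, Set.mem_ofPred_eq] at hx
      have := hx.1.2
      dsimp only
      omega
    · intro x _
      simp
  have h6 : hookCount k X = #{x ∈ X.filter (fun x => ¬ x < k) | x - k ∉ X} := by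
    rw [hookCount, filter_filter]
    simp only [not_lt]
  omega

/-! ### Beta-sets of Young diagrams -/

theorem rowLen_eq_of_forall_mem_iff {μ : YoungDiagram} {a n : ℕ} (h : ∀ b, (a, b) ∈ μ ↔ b < n) :
    μ.rowLen a = n := by
  refine le_antisymm ?_ ?_
  · by_contra hlt
    exact lt_irrefl n ((h n).1 (YoungDiagram.mem_iff_lt_rowLen.2 (not_le.1 hlt)))
  · by_contra hlt
    exact lt_irrefl _ (YoungDiagram.mem_iff_lt_rowLen.1 ((h _).2 (not_le.1 hlt)))

theorem lt_rowLen_iff_lt_colLen (μ : YoungDiagram) (i j : ℕ) :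
    j < μ.rowLen i ↔ i < μ.colLen j := by
  rw [← YoungDiagram.mem_iff_lt_rowLen, YoungDiagram.mem_iff_lt_colLen]

theorem rowLen_eq_zero_of_colLen_le {μ : YoungDiagram} {i : ℕ} (h : μ.colLen 0 ≤ i) :
    μ.rowLen i = 0 := by
  have := lt_rowLen_iff_lt_colLen μ i 0
  omega

theorem mem_betaSet {N y : ℕ} {μ : YoungDiagram} :
    y ∈ betaSet N μ ↔ ∃ i < N, μ.rowLen i + (N - 1 - i) = y := by
  simp [betaSet]

/-- The beads of different rows are different. -/
theorem betaSet_injOn (N : ℕ) (μ : YoungDiagram) :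
    Set.InjOn (fun i => μ.rowLen i + (N - 1 - i)) (range N : Set ℕ) := by
  intro a ha b hb h
  simp only [coe_range, Set.mem_Iio] at ha hb h
  rcases le_total a b with hab | hab
  · have := μ.rowLen_anti a b hab
    omega
  · have := μ.rowLen_anti b a hab
    omega

theorem card_betaSet (N : ℕ) (μ : YoungDiagram) : #(betaSet N μ) = N := by
  rw [betaSet, card_image_of_injOn (betaSet_injOn N μ), card_range]

theorem card_eq_sum_rowLen {N : ℕ} {μ : YoungDiagram} (hN : μ.colLen 0 ≤ N) :
    μ.card = ∑ i ∈ range N, μ.rowLen i := by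
  rw [YoungDiagram.card, card_eq_sum_card_fiberwise (f := Prod.fst) (t := range N)]
  · exact sum_congr rfl fun i _ => (YoungDiagram.rowLen_eq_card μ).symm
  · rintro ⟨a, b⟩ h
    have h' : (a, b) ∈ μ := by simpa using h
    have h0 := YoungDiagram.mem_iff_lt_colLen.1 (μ.up_left_mem le_rfl (Nat.zero_le b) h')
    simp only [coe_range, Set.mem_Iio]
    omega

theorem sum_betaSet {N : ℕ} {μ : YoungDiagram} (hN : μ.colLen 0 ≤ N) :
    ∑ x ∈ betaSet N μ, x = μ.card + N.choose 2 := by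
  rw [betaSet, sum_image (betaSet_injOn N μ), sum_add_distrib, sum_range_reflect (fun i => i) N,
    sum_range_id, Nat.choose_two_right, card_eq_sum_rowLen hN]

theorem card_eq_divHookCount_one {N : ℕ} {μ : YoungDiagram} (hN : μ.colLen 0 ≤ N) :
    μ.card = divHookCount 1 (betaSet N μ) := by
  have h1 := sum_betaSet hN
  have h2 := divHookCount_one_add_choose (betaSet N μ)
  rw [card_betaSet] at h2
  omega

theorem betaSet_succ {N : ℕ} {μ : YoungDiagram} (hN : μ.colLen 0 ≤ N) :
    betaSet (N + 1) μ = insert 0 ((betaSet N μ).image Nat.succ) := by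
  ext y
  simp only [mem_insert, mem_image, mem_betaSet, Nat.succ_eq_add_one]
  constructor
  · rintro ⟨i, hi, rfl⟩
    rcases Nat.lt_succ_iff_lt_or_eq.1 hi with h | rfl
    · exact Or.inr ⟨_, ⟨i, h, rfl⟩, by omega⟩
    · left
      rw [rowLen_eq_zero_of_colLen_le hN]
      omega
  · rintro (rfl | ⟨_, ⟨i, hi, rfl⟩, rfl⟩)
    · refine ⟨N, by omega, ?_⟩
      rw [rowLen_eq_zero_of_colLen_le hN]
      omega
    · exact ⟨i, by omega, by omega⟩

/-- The number of hooks of `μ` of length divisible by `m`, read off the beta-numbers of `μ`. -/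
def divHooks (m : ℕ) (μ : YoungDiagram) : ℕ :=
  divHookCount m (betaSet (μ.colLen 0) μ)

/-- The hook counts do not depend on the number of beads used to display a partition. -/
theorem divHooks_eq {m N : ℕ} {μ : YoungDiagram} (hN : μ.colLen 0 ≤ N) :
    divHooks m μ = divHookCount m (betaSet N μ) := by
  induction N, hN using Nat.le_induction with
  | base => rfl
  | succ N hN ih => rw [ih, betaSet_succ hN, divHookCount_insert_zero_image_succ]

theorem divHooks_one (μ : YoungDiagram) : divHooks 1 μ = μ.card :=
  (card_eq_divHookCount_one le_rfl).symm

/-! ### Deleting hooks -/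

theorem mem_deleteHook {μ : YoungDiagram} {i j a b : ℕ} :
    (a, b) ∈ deleteHook μ i j ↔
      b < μ.rowLen a ∧ ¬ (i ≤ a ∧ j ≤ b ∧ ¬ b + 1 < μ.rowLen (a + 1)) := by
  rw [← YoungDiagram.mem_cells]
  simp only [deleteHook, mem_filter, YoungDiagram.mem_cells, YoungDiagram.mem_iff_lt_rowLen]

/-- Row lengths after the deletion of the hook of `(i, j)`: the rows from `i` on that meet column
`j` move up by one row and lose one cell, and the last of them ends just before column `j`. -/
theorem rowLen_deleteHook {μ : YoungDiagram} {i j : ℕ} (hij : (i, j) ∈ μ) (a : ℕ) :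
    (deleteHook μ i j).rowLen a =
      if a < i then μ.rowLen a
      else if a + 1 < μ.colLen j then μ.rowLen (a + 1) - 1
      else if a + 1 = μ.colLen j then j
      else μ.rowLen a := by
  refine rowLen_eq_of_forall_mem_iff fun b => ?_
  rw [mem_deleteHook]
  have h1 := lt_rowLen_iff_lt_colLen μ a j
  have h2 := lt_rowLen_iff_lt_colLen μ (a + 1) j
  have h3 := μ.rowLen_anti a (a + 1) (by omega)
  have h4 := YoungDiagram.mem_iff_lt_colLen.1 hij
  split_ifs <;> omega

theorem colLen_deleteHook_le (μ : YoungDiagram) (i j : ℕ) :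
    (deleteHook μ i j).colLen 0 ≤ μ.colLen 0 := by
  rw [YoungDiagram.colLen_eq_card, YoungDiagram.colLen_eq_card]
  exact card_le_card (filter_subset_filter _ (filter_subset _ _))

/-- The place `hookLength μ i j` below the `i`-th bead: it has exactly `j` free places below it,
and above it are the beads of the rows that meet column `j`. -/
theorem sub_hookLength {N : ℕ} {μ : YoungDiagram} {i j : ℕ} (hij : (i, j) ∈ μ)
    (hN : μ.colLen 0 ≤ N) :
    hookLength μ i j ≤ μ.rowLen i + (N - 1 - i) ∧
      μ.rowLen i + (N - 1 - i) - hookLength μ i j = j + N - μ.colLen j := by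
  have h1 := YoungDiagram.mem_iff_lt_colLen.1 hij
  have h2 := YoungDiagram.mem_iff_lt_rowLen.1 hij
  have h3 := μ.colLen_anti 0 j (Nat.zero_le j)
  unfold hookLength
  omega

theorem sub_hookLength_notMem_betaSet {N : ℕ} {μ : YoungDiagram} {i j : ℕ} (hij : (i, j) ∈ μ)
    (hN : μ.colLen 0 ≤ N) :
    μ.rowLen i + (N - 1 - i) - hookLength μ i j ∉ betaSet N μ := by
  rw [(sub_hookLength hij hN).2, mem_betaSet]
  rintro ⟨a, ha, h⟩
  have h1 := lt_rowLen_iff_lt_colLen μ a j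
  have h3 := μ.colLen_anti 0 j (Nat.zero_le j)
  omega

/-- Deleting a hook of length `h` means moving a bead down by `h` places. -/
theorem betaSet_deleteHook {N : ℕ} {μ : YoungDiagram} {i j : ℕ} (hij : (i, j) ∈ μ)
    (hN : μ.colLen 0 ≤ N) :
    betaSet N (deleteHook μ i j) =
      insert (μ.rowLen i + (N - 1 - i) - hookLength μ i j)
        ((betaSet N μ).erase (μ.rowLen i + (N - 1 - i))) := by
  have h1 := YoungDiagram.mem_iff_lt_colLen.1 hij
  have h3 := μ.colLen_anti 0 j (Nat.zero_le j)
  ext y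
  rw [(sub_hookLength hij hN).2]
  simp only [mem_insert, mem_erase, mem_betaSet, rowLen_deleteHook hij]
  constructor
  · rintro ⟨a, ha, rfl⟩
    have h4 := lt_rowLen_iff_lt_colLen μ (a + 1) j
    split_ifs with c1 c2 c3
    · have := μ.rowLen_anti a i c1.le
      exact Or.inr ⟨by omega, a, ha, rfl⟩
    · have := μ.rowLen_anti i (a + 1) (by omega)
      exact Or.inr ⟨by omega, a + 1, by omega, by omega⟩
    · left
      omega
    · have := μ.rowLen_anti i a (by omega)
      exact Or.inr ⟨by omega, a, ha, rfl⟩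
  · rintro (rfl | ⟨hne, a, ha, rfl⟩)
    · refine ⟨μ.colLen j - 1, by omega, ?_⟩
      rw [if_neg (by omega), if_neg (by omega), if_pos (by omega)]
      omega
    · rcases lt_trichotomy a i with c1 | rfl | c1
      · exact ⟨a, ha, by rw [if_pos c1]⟩
      · exact absurd rfl hne
      · by_cases c2 : a < μ.colLen j
        · have h4 := lt_rowLen_iff_lt_colLen μ a j
          refine ⟨a - 1, by omega, ?_⟩
          rw [if_neg (by omega), if_pos (by omega), Nat.sub_add_cancel (by omega)]
          omega
        · refine ⟨a, ha, ?_⟩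
          rw [if_neg (by omega), if_neg (by omega), if_neg (by omega)]

/-- Each bead together with a free place below it comes from a hook. -/
theorem exists_hookLength_eq {N : ℕ} {μ : YoungDiagram} (hN : μ.colLen 0 ≤ N) {i z : ℕ}
    (hi : i < N) (hz : z < μ.rowLen i + (N - 1 - i)) (hzn : z ∉ betaSet N μ) :
    ∃ j, (i, j) ∈ μ ∧ hookLength μ i j = μ.rowLen i + (N - 1 - i) - z := by
  -- `l` is the number of beads above `z`; the wanted column is the number of free places below `z`
  have hex : ∃ l, l = N ∨ μ.rowLen l + (N - 1 - l) < z := ⟨N, Or.inl rfl⟩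
  obtain ⟨l, hspec, hmin⟩ : ∃ l, (l = N ∨ μ.rowLen l + (N - 1 - l) < z) ∧
      ∀ a < l, a ≠ N ∧ z ≤ μ.rowLen a + (N - 1 - a) := by
    refine ⟨Nat.find hex, Nat.find_spec hex, fun a ha => ?_⟩
    simpa only [not_or, not_lt] using Nat.find_min hex ha
  have hlN : l ≤ N := by
    by_contra h
    exact (hmin N (not_le.1 h)).1 rfl
  have hil : i < l := by
    by_contra h
    have := μ.rowLen_anti l i (not_lt.1 h)
    omega
  have hprev := (hmin (l - 1) (by omega)).2
  have hprev' : μ.rowLen (l - 1) + (N - 1 - (l - 1)) ≠ z := fun h =>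
    hzn (mem_betaSet.2 ⟨l - 1, by omega, h⟩)
  have h1 := lt_rowLen_iff_lt_colLen μ (l - 1) (z + l - N)
  have h2 := lt_rowLen_iff_lt_colLen μ l (z + l - N)
  have h3 := lt_rowLen_iff_lt_colLen μ i (z + l - N)
  have h4 := μ.rowLen_anti i (l - 1) (by omega)
  have h5 : l = N → μ.rowLen l = 0 := fun h => rowLen_eq_zero_of_colLen_le (h ▸ hN)
  have h6 : μ.colLen (z + l - N) = l := by omega
  refine ⟨z + l - N, YoungDiagram.mem_iff_lt_rowLen.2 (by omega), ?_⟩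
  unfold hookLength
  omega

theorem IsCore.divHooks_eq_zero {t : ℕ} {μ : YoungDiagram} (h : IsCore t μ) :
    divHooks t μ = 0 := by
  rw [divHooks, divHookCount]
  refine sum_eq_zero fun x hx => card_eq_zero.2 (filter_eq_empty_iff.2 ?_)
  rintro z hz ⟨hzn, hd⟩
  obtain ⟨i, hi, rfl⟩ := mem_betaSet.1 hx
  obtain ⟨j, hij, hj⟩ := exists_hookLength_eq le_rfl hi (mem_range.1 hz) hzn
  exact h i j hij (hj ▸ hd)

theorem HookStep.card_add {t : ℕ} (ht : 0 < t) {μ ν : YoungDiagram} (h : HookStep t μ ν) :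
    μ.card + t * divHooks t ν = ν.card + t * divHooks t μ := by
  obtain ⟨i, j, hij, ⟨k, hk⟩, rfl⟩ := h
  have hN := colLen_deleteHook_le μ i j
  have hi : μ.rowLen i + (μ.colLen 0 - 1 - i) ∈ betaSet (μ.colLen 0) μ := by
    have h1 := YoungDiagram.mem_iff_lt_colLen.1 hij
    have h3 := μ.colLen_anti 0 j (Nat.zero_le j)
    exact mem_betaSet.2 ⟨i, by omega, rfl⟩
  have hle := (sub_hookLength hij le_rfl).1
  have hn := sub_hookLength_notMem_betaSet hij le_rfl
  have hs := sum_betaSet hN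
  have hs' := sum_betaSet (le_refl (μ.colLen 0))
  rw [divHooks_eq hN, divHooks, betaSet_deleteHook hij le_rfl]
  rw [betaSet_deleteHook hij le_rfl, sum_insert fun h => hn (mem_of_mem_erase h)] at hs
  rw [← add_sum_erase _ _ hi] at hs'
  rw [hk] at hs hle hn ⊢
  rw [← divHookCount_insert_erase ht hi hle hn, mul_add]
  omega

/-- The size of a partition is the size of its `t`-core plus `t` times the number of its hooks of
length divisible by `t`. -/
theorem card_core_add {t : ℕ} (ht : 0 < t) (μ : YoungDiagram) :
    (core t μ).card + t * divHooks t μ = μ.card := by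
  obtain ⟨h, hc⟩ : IsCoreOf t μ (core t μ) := Classical.choose_spec (exists_isCoreOf t μ)
  have key : ∀ κ, Relation.ReflTransGen (HookStep t) μ κ →
      μ.card + t * divHooks t κ = κ.card + t * divHooks t μ := by
    intro κ hκ
    induction hκ with
    | refl => rfl
    | tail _ hs ih =>
      have := hs.card_add ht
      omega
  have := key _ h
  rw [hc.divHooks_eq_zero] at this
  omega

/-! ### Quotients and the core tower -/

theorem colLen_ofBetaSet_le (Y : Finset ℕ) : (ofBetaSet Y).colLen 0 ≤ #Y := by
  by_contra h
  obtain ⟨h1, -⟩ := YoungDiagram.mem_ofRowLens.1 (YoungDiagram.mem_iff_lt_colLen.2 (not_le.1 h))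
  simp at h1

theorem card_filter_lt_sort_getElem (Y : Finset ℕ) (i : ℕ) (hi : i < (Y.sort (· ≥ ·)).length) :
    #{y ∈ Y | y < (Y.sort (· ≥ ·))[i]} = #Y - 1 - i := by
  have hs := (Finset.sortedGT_sort Y).pairwise
  rw [List.pairwise_iff_getElem] at hs
  have : Y.filter (fun y => y < (Y.sort (· ≥ ·))[i])
      = ((Y.sort (· ≥ ·)).drop (i + 1)).toFinset := by
    ext y
    simp only [mem_filter, List.mem_toFinset, List.mem_drop_iff_getElem]
    constructor
    · rintro ⟨hy, hlt⟩
      obtain ⟨k, hk, rfl⟩ := List.getElem_of_mem ((Finset.mem_sort (· ≥ ·)).2 hy)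
      have hik : i < k := by
        by_contra h
        rcases (not_lt.1 h).lt_or_eq with h' | rfl
        · exact lt_asymm hlt (hs k i hk hi h')
        · exact lt_irrefl _ hlt
      exact ⟨k - (i + 1), by omega, by congr 1; omega⟩
    · rintro ⟨k, hk, rfl⟩
      exact ⟨(Finset.mem_sort (· ≥ ·)).1 (List.getElem_mem _), hs i _ hi _ (by omega)⟩
  rw [this, List.toFinset_card_of_nodup ((Finset.sort_nodup _ _).sublist (List.drop_sublist _ _)),
    List.length_drop, Finset.length_sort]
  omega

/-- The partition read off a set of beads has this set as its beta-set. -/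
theorem betaSet_ofBetaSet (Y : Finset ℕ) : betaSet (#Y) (ofBetaSet Y) = Y := by
  have key : ∀ i (hi : i < (Y.sort (· ≥ ·)).length),
      (ofBetaSet Y).rowLen i + (#Y - 1 - i) = (Y.sort (· ≥ ·))[i] := by
    intro i hi
    have h1 : (ofBetaSet Y).rowLen i = gaps Y (Y.sort (· ≥ ·))[i] := by
      have := YoungDiagram.rowLen_ofRowLens (w := (Y.sort (· ≥ ·)).map (gaps Y))
        (hw := List.sortedGE_iff_pairwise.2
          (List.Pairwise.map (gaps Y) (fun _ _ h => gaps_mono Y h)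
            (Finset.pairwise_sort Y (· ≥ ·)))) ⟨i, by simpa using hi⟩
      simpa [ofBetaSet] using this
    rw [h1, gaps, ← card_filter_lt_sort_getElem Y i hi, card_sdiff,
      show Y ∩ range (Y.sort (· ≥ ·))[i] = {y ∈ Y | y < (Y.sort (· ≥ ·))[i]} by
        ext y
        simp]
    have hle : #{y ∈ Y | y < (Y.sort (· ≥ ·))[i]} ≤ #(range (Y.sort (· ≥ ·))[i]) :=
      card_le_card fun y hy => mem_range.2 (mem_filter.1 hy).2
    rw [Nat.sub_add_cancel hle, card_range]
  ext y
  rw [mem_betaSet]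
  constructor
  · rintro ⟨i, hi, rfl⟩
    rw [key i (by simpa using hi)]
    exact (Finset.mem_sort (· ≥ ·)).1 (List.getElem_mem _)
  · intro hy
    obtain ⟨k, hk, rfl⟩ := List.getElem_of_mem ((Finset.mem_sort (· ≥ ·)).2 hy)
    exact ⟨k, by simpa using hk, key k hk⟩

theorem divHooks_ofBetaSet (m : ℕ) (Y : Finset ℕ) :
    divHooks m (ofBetaSet Y) = divHookCount m Y := by
  rw [divHooks_eq (colLen_ofBetaSet_le Y), betaSet_ofBetaSet]

/-- Hooks of length divisible by `m` in the `t`-quotient are hooks of length divisible by `t * m`.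
Only the totals over all runners matter here, so the number of beads plays no role, even though
changing it by a non-multiple of `t` permutes the runners. -/
theorem sum_divHooks_quotient {t : ℕ} (ht : 0 < t) (m : ℕ) (μ : YoungDiagram) :
    ((quotient t μ).map (divHooks m)).sum = divHooks (t * m) μ := by
  rw [divHooks_eq (Nat.le_mul_of_pos_left _ ht), ← sum_divHookCount_runner t m ht, quotient,
    List.map_map, Finset.sum_range, ← List.sum_ofFn, List.ofFn_eq_map,
    ← List.map_coe_finRange_eq_range, List.map_map]
  simp [Function.comp_def, divHooks_ofBetaSet]

theorem sum_divHooks_preTowerRow {t : ℕ} (ht : 0 < t) (m : ℕ) (μ : YoungDiagram) (j : ℕ) :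
    ((preTowerRow t μ j).map (divHooks m)).sum = divHooks (t ^ j * m) μ := by
  induction j generalizing m with
  | zero => simp [preTowerRow]
  | succ j ih =>
    have : ∀ L : List YoungDiagram, ((L.flatMap (quotient t)).map (divHooks m)).sum =
        (L.map (divHooks (t * m))).sum := by
      intro L
      induction L with
      | nil => rfl
      | cons ν L ihL => simp [ihL, sum_divHooks_quotient ht]
    rw [preTowerRow, this, ih, pow_succ, mul_assoc]

/-- The size of the `j`-th row of the `t`-core tower, in terms of hook counts. -/
theorem totalSize_towerRow {t : ℕ} (ht : 0 < t) (μ : YoungDiagram) (j : ℕ) :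
    totalSize (towerRow t μ j) + t * divHooks (t ^ (j + 1)) μ = divHooks (t ^ j) μ := by
  have : ∀ L : List YoungDiagram, totalSize (L.map (core t)) + t * (L.map (divHooks t)).sum =
      (L.map (divHooks 1)).sum := by
    intro L
    induction L with
    | nil => rfl
    | cons ν L ihL =>
      have := card_core_add ht ν
      simp only [totalSize, List.map_cons, List.sum_cons, divHooks_one, mul_add] at ihL ⊢
      omega
  rw [towerRow, pow_succ, ← sum_divHooks_preTowerRow ht, this, sum_divHooks_preTowerRow ht, mul_one]

/-! ### Counting hooks over all partitions of a given size -/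

theorem sum_rowLens (μ : YoungDiagram) : μ.rowLens.sum = μ.card := by
  rw [card_eq_sum_rowLen le_rfl, YoungDiagram.rowLens, ← List.sum_toFinset _ List.nodup_range,
    List.toFinset_range]

theorem rowLens_diagram {n : ℕ} (p : n.Partition) :
    (diagram p).rowLens = p.parts.sort (· ≥ ·) :=
  YoungDiagram.rowLens_ofRowLens_eq_self fun _ hx => p.parts_pos ((Multiset.mem_sort _).1 hx)

theorem card_diagram {n : ℕ} (p : n.Partition) : (diagram p).card = n := by
  rw [← sum_rowLens, rowLens_diagram, ← Multiset.sum_coe, Multiset.sort_eq, p.parts_sum]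

theorem diagram_injective (n : ℕ) : Function.Injective (diagram : n.Partition → YoungDiagram) := by
  intro p q h
  have h' := congrArg YoungDiagram.rowLens h
  rw [rowLens_diagram, rowLens_diagram] at h'
  ext1
  rw [← Multiset.sort_eq p.parts (· ≥ ·), h', Multiset.sort_eq]

theorem exists_diagram_eq (μ : YoungDiagram) : ∃ p : μ.card.Partition, diagram p = μ := by
  refine ⟨⟨μ.rowLens, fun {i} h => μ.pos_of_mem_rowLens i (by simpa using h), by
    rw [Multiset.sum_coe, sum_rowLens]⟩, ?_⟩
  apply YoungDiagram.equivListRowLens.injective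
  ext1
  change (diagram _).rowLens = μ.rowLens
  rw [rowLens_diagram, Multiset.coe_sort]
  exact List.mergeSort_eq_self _ (by simpa using (List.sortedGE_iff_pairwise.1 μ.rowLens_sorted))

theorem colLen_le_card (μ : YoungDiagram) : μ.colLen 0 ≤ μ.card := by
  rw [YoungDiagram.colLen_eq_card]
  exact card_le_card (filter_subset _ _)

/-- A partition is determined by its beta-set: listed upwards, the beads form a strictly increasing
sequence, which is determined by its range. -/
theorem betaSet_inj {N : ℕ} {μ ν : YoungDiagram} (hμ : μ.colLen 0 ≤ N) (hν : ν.colLen 0 ≤ N)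
    (h : betaSet N μ = betaSet N ν) : μ = ν := by
  have hmono : ∀ κ : YoungDiagram,
      StrictMono fun i : Fin N => κ.rowLen (N - 1 - i) + (i : ℕ) := by
    intro κ a b hab
    have := κ.rowLen_anti (N - 1 - b) (N - 1 - a) (by omega)
    have : (a : ℕ) < b := hab
    dsimp only
    omega
  have hrange : ∀ κ : YoungDiagram,
      Set.range (fun i : Fin N => κ.rowLen (N - 1 - i) + (i : ℕ)) = betaSet N κ := by
    intro κ
    ext y
    rw [mem_coe, mem_betaSet]
    constructor
    · rintro ⟨i, rfl⟩
      exact ⟨N - 1 - i, by omega, by dsimp only; omega⟩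
    · rintro ⟨i, hi, rfl⟩
      exact ⟨⟨N - 1 - i, by omega⟩, by simp [show N - 1 - (N - 1 - i) = i by omega]⟩
  have hfun := ((hmono μ).range_inj (hmono ν)).1 (by rw [hrange, hrange, h])
  have hrow : ∀ i, μ.rowLen i = ν.rowLen i := by
    intro i
    rcases lt_or_ge i N with hi | hi
    · have := congrFun hfun ⟨N - 1 - i, by omega⟩
      simpa [show N - 1 - (N - 1 - i) = i by omega] using this
    · rw [rowLen_eq_zero_of_colLen_le (hμ.trans hi), rowLen_eq_zero_of_colLen_le (hν.trans hi)]
  ext ⟨a, b⟩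
  simp only [YoungDiagram.mem_cells, YoungDiagram.mem_iff_lt_rowLen, hrow]

/-- The sets of `N` beta-numbers of the partitions of `n`. -/
def betaSets (N n : ℕ) : Finset (Finset ℕ) :=
  univ.image fun p : n.Partition => betaSet N (diagram p)

theorem colLen_diagram_le {n N : ℕ} (hN : n ≤ N) (p : n.Partition) :
    (diagram p).colLen 0 ≤ N :=
  (colLen_le_card _).trans (by rwa [card_diagram])

theorem sum_betaSets {N n : ℕ} (hN : n ≤ N) (f : Finset ℕ → ℕ) :
    ∑ X ∈ betaSets N n, f X = ∑ p : n.Partition, f (betaSet N (diagram p)) := by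
  refine sum_image fun p _ q _ h => diagram_injective n ?_
  exact betaSet_inj (colLen_diagram_le hN p) (colLen_diagram_le hN q) h

/-- For `N ≥ n` every `N`-element set with the right sum is the beta-set of a partition of `n`. -/
theorem mem_betaSets {N n : ℕ} (hN : n ≤ N) {X : Finset ℕ} :
    X ∈ betaSets N n ↔ #X = N ∧ ∑ x ∈ X, x = n + N.choose 2 := by
  simp only [betaSets, mem_image, mem_univ, true_and]
  constructor
  · rintro ⟨p, rfl⟩
    exact ⟨card_betaSet _ _, by rw [sum_betaSet (colLen_diagram_le hN p), card_diagram]⟩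
  · rintro ⟨rfl, h⟩
    have hs := sum_betaSet (colLen_ofBetaSet_le X)
    rw [betaSet_ofBetaSet, h] at hs
    obtain rfl : n = (ofBetaSet X).card := Nat.add_right_cancel hs
    obtain ⟨p, hp⟩ := exists_diagram_eq (ofBetaSet X)
    exact ⟨p, by rw [hp, betaSet_ofBetaSet]⟩

theorem range_subset_of_mem_betaSets {N n k : ℕ} (hN : n + k ≤ N) {X : Finset ℕ}
    (hX : X ∈ betaSets N n) : range k ⊆ X := by
  obtain ⟨p, -, rfl⟩ := mem_image.1 hX
  intro y hy
  have hy := mem_range.1 hy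
  refine mem_betaSet.2 ⟨N - 1 - y, by omega, ?_⟩
  rw [rowLen_eq_zero_of_colLen_le (colLen_diagram_le (N := N - 1 - y) (by omega) p)]
  omega

/-- Otherwise moving the bead down would leave a set of `N` beads with sum below `N.choose 2`. -/
theorem hookCount_eq_zero {N n k : ℕ} (hN : n ≤ N) (hk : n < k) {X : Finset ℕ}
    (hX : X ∈ betaSets N n) : hookCount k X = 0 := by
  refine card_eq_zero.2 (filter_eq_empty_iff.2 ?_)
  rintro x hx ⟨hkx, hn⟩
  obtain ⟨h1, h2⟩ := (mem_betaSets hN).1 hX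
  have hn' : x - k ∉ X.erase x := fun h => hn (mem_of_mem_erase h)
  have h3 := divHookCount_one_add_choose (insert (x - k) (X.erase x))
  rw [card_insert_of_notMem hn', card_erase_add_one hx, sum_insert hn', h1] at h3
  rw [← add_sum_erase X _ hx] at h2
  omega

/-- Moving a bead down by `k` places is a bijection between partitions of `n + k` with a marked
hook of length `k` and partitions of `n` with a marked bead that can be moved up by `k`. -/
theorem sum_hookCount_add {N n k : ℕ} (hN : n + k ≤ N) (hk : 0 < k) :
    ∑ X ∈ betaSets N (n + k), hookCount k X = ∑ X ∈ betaSets N n, (hookCount k X + k) := by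
  have h : ∑ X ∈ betaSets N n, (hookCount k X + k) =
      ∑ X ∈ betaSets N n, #{x ∈ X | x + k ∉ X} :=
    sum_congr rfl fun X hX => (card_filter_add_notMem (range_subset_of_mem_betaSets hN hX)).symm
  rw [h]
  unfold hookCount
  rw [← card_sigma, ← card_sigma]
  refine card_nbij' (fun a => ⟨insert (a.2 - k) (a.1.erase a.2), a.2 - k⟩)
    (fun a => ⟨insert (a.2 + k) (a.1.erase a.2), a.2 + k⟩) ?_ ?_ ?_ ?_
  · rintro ⟨X, x⟩ h
    simp only [coe_sigma, Set.mem_sigma_iff, mem_coe, mem_filter, mem_betaSets hN,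
      mem_betaSets ((Nat.le_add_right n k).trans hN)] at h ⊢
    obtain ⟨⟨h1, h2⟩, h3, h4, h5⟩ := h
    have hn' : x - k ∉ X.erase x := fun h => h5 (mem_of_mem_erase h)
    rw [← add_sum_erase X _ h3] at h2
    refine ⟨⟨?_, ?_⟩, mem_insert_self _ _, ?_⟩
    · rw [card_insert_of_notMem hn', card_erase_add_one h3, h1]
    · rw [sum_insert hn']
      omega
    · rw [Nat.sub_add_cancel h4]
      simp only [mem_insert, mem_erase, ne_eq, not_true_eq_false, false_and, or_false]
      omega
  · rintro ⟨X, x⟩ h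
    simp only [coe_sigma, Set.mem_sigma_iff, mem_coe, mem_filter, mem_betaSets hN,
      mem_betaSets ((Nat.le_add_right n k).trans hN)] at h ⊢
    obtain ⟨⟨h1, h2⟩, h3, h5⟩ := h
    have hn' : x + k ∉ X.erase x := fun h => h5 (mem_of_mem_erase h)
    rw [← add_sum_erase X _ h3] at h2
    refine ⟨⟨?_, ?_⟩, mem_insert_self _ _, by omega, ?_⟩
    · rw [card_insert_of_notMem hn', card_erase_add_one h3, h1]
    · rw [sum_insert hn']
      omega
    · rw [Nat.add_sub_cancel]
      simp only [mem_insert, mem_erase, ne_eq, not_true_eq_false, false_and, or_false]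
      omega
  · rintro ⟨X, x⟩ h
    simp only [coe_sigma, Set.mem_sigma_iff, mem_coe, mem_filter] at h
    obtain ⟨-, h3, h4, h5⟩ := h
    have hn' : x - k ∉ X.erase x := fun h => h5 (mem_of_mem_erase h)
    simp only [Nat.sub_add_cancel h4, erase_insert hn', insert_erase h3]
  · rintro ⟨X, x⟩ h
    simp only [coe_sigma, Set.mem_sigma_iff, mem_coe, mem_filter] at h
    obtain ⟨-, h3, h5⟩ := h
    have hn' : x + k ∉ X.erase x := fun h => h5 (mem_of_mem_erase h)
    simp only [Nat.add_sub_cancel, erase_insert hn', insert_erase h3]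

theorem card_betaSets {N n : ℕ} (hN : n ≤ N) : #(betaSets N n) = Fintype.card n.Partition := by
  rw [card_eq_sum_ones, sum_betaSets hN fun _ => 1, sum_const, smul_eq_mul, mul_one, card_univ]

/-- The number of hooks of length `k` of all partitions of `n`: the recursion
`sum_hookCount_add` unrolled. -/
theorem sum_hookCount {N n k : ℕ} (hN : n ≤ N) (hk : 0 < k) :
    ∑ X ∈ betaSets N n, hookCount k X =
      ∑ s ∈ Icc 1 n with k ∣ s, k * Fintype.card (n - s).Partition := by
  induction n using Nat.strong_induction_on with
  | _ n ih =>
    rcases lt_or_ge n k with hlt | hle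
    · rw [sum_eq_zero fun X hX => hookCount_eq_zero hN hlt hX, filter_false_of_mem, sum_empty]
      intro s hs hd
      have := mem_Icc.1 hs
      have := Nat.le_of_dvd (by omega) hd
      omega
    · obtain ⟨n, rfl⟩ := Nat.exists_eq_add_of_le' hle
      have hset : (Icc 1 (n + k)).filter (k ∣ ·) =
          insert k (((Icc 1 n).filter (k ∣ ·)).image (· + k)) := by
        ext s
        simp only [mem_filter, mem_Icc, mem_insert, mem_image]
        constructor
        · rintro ⟨⟨h1, h2⟩, h3⟩
          have h4 := Nat.le_of_dvd (by omega) h3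
          rcases h4.eq_or_lt with h5 | h5
          · exact Or.inl h5.symm
          · exact Or.inr ⟨s - k, ⟨by omega, Nat.dvd_sub h3 dvd_rfl⟩, by omega⟩
        · rintro (rfl | ⟨s, ⟨h1, h2⟩, rfl⟩)
          · exact ⟨by omega, dvd_rfl⟩
          · exact ⟨by omega, Nat.dvd_add h2 dvd_rfl⟩
      have hk' : k ∉ ((Icc 1 n).filter (k ∣ ·)).image (· + k) := by
        simp only [mem_filter, mem_Icc, mem_image, not_exists, not_and]
        intro s hs
        omega
      rw [sum_hookCount_add hN hk, hset, sum_insert hk',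
        sum_image fun a _ b _ h => Nat.add_right_cancel h, sum_add_distrib, sum_const,
        card_betaSets (by omega), ih n (by omega) (by omega), Nat.add_sub_cancel, smul_eq_mul,
        add_comm, mul_comm k]
      simp only [Nat.add_sub_add_right]

theorem sum_filter_mul_dvd {m s K : ℕ} (hm : 0 < m) (hs : 0 < s) (hK : s ≤ K) :
    ∑ l ∈ Icc 1 K with m * l ∣ s, m * l =
      if m ∣ s then m * ArithmeticFunction.sigma 1 (s / m) else 0 := by
  split_ifs with h
  · obtain ⟨u, rfl⟩ := h
    have hu : 0 < u := Nat.pos_of_mul_pos_left hs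
    rw [Nat.mul_div_cancel_left u hm, ArithmeticFunction.sigma_one_apply, mul_sum]
    refine sum_congr ?_ fun _ _ => rfl
    ext l
    simp only [mem_filter, mem_Icc, Nat.mem_divisors, Nat.mul_dvd_mul_iff_left hm]
    constructor
    · rintro ⟨-, h⟩
      exact ⟨h, hu.ne'⟩
    · rintro ⟨h, -⟩
      have h1 := Nat.le_of_dvd hu h
      have h2 := Nat.pos_of_dvd_of_pos h hu
      have h3 : u ≤ m * u := Nat.le_mul_of_pos_left u hm
      exact ⟨by omega, h⟩
  · rw [filter_false_of_mem, sum_empty]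
    exact fun l _ hl => h ((Dvd.intro l rfl).trans hl)

/-- The number of hooks of length divisible by `m` of all partitions of `n`. -/
theorem sum_divHooks_diagram {m : ℕ} (hm : 0 < m) (n : ℕ) :
    ∑ p : n.Partition, divHooks m (diagram p) =
      ∑ s ∈ Icc 1 n, (if m ∣ s then m * ArithmeticFunction.sigma 1 (s / m) else 0) *
        Fintype.card (n - s).Partition := by
  have h1 : ∑ p : n.Partition, divHooks m (diagram p) =
      ∑ X ∈ betaSets n n, divHookCount m X := by
    rw [sum_betaSets le_rfl]
    exact sum_congr rfl fun p _ => divHooks_eq (colLen_diagram_le le_rfl p)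
  -- every bead of a beta-set is at most the sum of the beads, so this bounds all hook lengths
  have h2 : ∀ X ∈ betaSets n n, ∀ x ∈ X, x ≤ n + n.choose 2 := by
    intro X hX x hx
    rw [← ((mem_betaSets le_rfl).1 hX).2]
    exact single_le_sum (f := fun x => x) (fun _ _ => Nat.zero_le _) hx
  rw [h1, sum_congr rfl fun X hX => divHookCount_eq_sum_hookCount hm (h2 X hX), sum_comm,
    sum_congr rfl fun l hl => sum_hookCount le_rfl (Nat.mul_pos hm (mem_Icc.1 hl).1)]
  simp only [sum_filter]
  rw [sum_comm]
  refine sum_congr rfl fun s hs => ?_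
  have hs := mem_Icc.1 hs
  rw [← sum_filter_mul_dvd hm hs.1 (hs.2.trans (Nat.le_add_right n (n.choose 2))), sum_filter,
    sum_mul]
  simp only [ite_mul, zero_mul]

/-! ### Generating functions -/

open scoped PowerSeries.WithPiTopology in
/-- Euler's product formula for the generating function of the partition numbers. -/
theorem mk_card_partition_eq_qInf_inv :
    (PowerSeries.mk fun n => (Fintype.card n.Partition : ℚ)) = qInf⁻¹ := by
  have hc : PowerSeries.constantCoeff qInf ≠ 0 := by simp [constantCoeff_qInf]
  rw [PowerSeries.eq_inv_iff_mul_eq_one hc]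
  have h := (Nat.Partition.hasProd_powerSeriesMk_card_restricted ℚ fun _ => True).mul hasProd_qInf
  have h1 : (fun i : ℕ => (if True then ∑' j : ℕ, (PowerSeries.X : PowerSeries ℚ) ^ ((i + 1) * j)
      else 1) * (1 - PowerSeries.X ^ (i + 1))) = fun _ => 1 := by
    funext i
    simp_rw [if_true, pow_mul]
    exact PowerSeries.WithPiTopology.tsum_pow_mul_one_sub_of_constantCoeff_eq_zero (by simp)
  rw [h1] at h
  have h2 := h.unique hasProd_one
  simpa [Nat.Partition.restricted, card_univ] using h2

/-- Weighting each partition by its number of hooks of length divisible by `m` gives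
`m G(q^m) / (q)_∞`. -/
theorem partitionSeries_divHooks {m : ℕ} (hm : m ≠ 0) :
    partitionSeries (divHooks m) = (m : ℚ) • PowerSeries.expand m hm G20 * qInf⁻¹ := by
  rw [← mk_card_partition_eq_qInf_inv]
  ext n
  rw [partitionSeries, PowerSeries.coeff_mk, ← Nat.cast_sum,
    sum_divHooks_diagram (Nat.pos_of_ne_zero hm), PowerSeries.coeff_mul,
    Nat.sum_antidiagonal_eq_sum_range_succ_mk, Nat.cast_sum]
  refine sum_subset_zero_on_sdiff ?_ ?_ ?_
  · intro s hs
    have := mem_Icc.1 hs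
    exact mem_range.2 (by omega)
  · intro s hs
    obtain rfl : s = 0 := by
      simp only [mem_sdiff, mem_range, mem_Icc] at hs
      omega
    simp [PowerSeries.coeff_expand, G20]
  · intro s _
    simp [PowerSeries.coeff_expand, G20]

theorem T_eq {t : ℕ} (ht : 0 < t) (j : ℕ) :
    T j t = partitionSeries (divHooks (t ^ j)) -
      (t : ℚ) • partitionSeries (divHooks (t ^ (j + 1))) := by
  ext n
  simp only [T, partitionSeries, PowerSeries.coeff_mk, map_sub, PowerSeries.coeff_smul, mul_sum,
    ← sum_sub_distrib, smul_eq_mul]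
  refine sum_congr rfl fun p _ => ?_
  rw [← totalSize_towerRow ht]
  push_cast
  ring

end CoreTower

open CoreTower in
theorem theorem1p1 :
    (∀ (t j : ℕ) (ht : 2 ≤ t),
      T j t =
        ((t : ℚ) ^ j • PowerSeries.expand (t ^ j) (pow_ne_zero j (by omega)) G20
          - (t : ℚ) ^ (j + 2) •
              PowerSeries.expand (t ^ (j + 1)) (pow_ne_zero (j + 1) (by omega)) G20) * qInf⁻¹) ∧
    (∀ t : ℕ, 2 ≤ t → T 0 t = partitionSeries fun μ => (core t μ).card) := by
  constructor
  · intro t j ht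
    have ht0 : t ≠ 0 := by omega
    rw [T_eq (by omega), partitionSeries_divHooks (pow_ne_zero j ht0),
      partitionSeries_divHooks (pow_ne_zero (j + 1) ht0), sub_mul, ← smul_mul_assoc, smul_smul]
    push_cast
    rw [← pow_succ']
  · intro t _
    simp [T, totalSize, towerRow, preTowerRow]
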